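/- Let $P_0$ be a probability distribution on $\mathbb{R}$ with finite support, and let $\lambda \ge 0$. For $n \ge 1$ let $X_1,\dots,X_n$ be i.i.d. with law $P_0$ and let $Z_{i,j}$, $1\le i<j\le n$, be i.i.d. $\mathcal{N}(0,1)$, independent of $(X_i)$. For $x\in\mathbb{R}^n$ put $$H_n(x) = \sum_{1\le i<j\le n} \Big( \sqrt{\tfrac{\lambda}{n}}\, x_i x_j Z_{i,j} + \tfrac{\lambda}{n} X_i X_j x_i x_j - \tfrac{\lambda}{2n} x_i^2 x_j^2 \Big), \qquad F_n(\lambda) = \frac1n\, \mathbb{E}\Big[ \log \int e^{H_n(x)} \, dP_0^{\otimes n}(x) \Big].$$ For $q \ge 0$ put $$\mathcal{F}(\lambda,q) = \mathbb{E} \log \left( \int \exp\Big( \sqrt{\lambda q}\, Z x + \lambda q\, x X - \tfrac{\lambda q}{2} x^2 \Big) dP_0(x) \right) - \frac{\lambda}{4} q^2,$$ where $X\sim P_0$ and $Z\sim\mathcal{N}(0,1)$ are independent. Then all the expectations above are well defined and finite, and $$\liminf_{n\to\infty} F_n(\lambda) \ \ge\ \sup_{q\ge 0} \mathcal{F}(\lambda,q).$$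 -/

import Mathlib

open MeasureTheory ProbabilityTheory Filter

noncomputable section

namespace SpikedWigner

/-- The index set of the observations: the pairs `i < j` of elements of `Fin n`. -/
abbrev Pairs (n : ℕ) : Type := {p : Fin n × Fin n // p.1 < p.2}

/-- The random Hamiltonian
`∑_{i<j} √(l/n) x_i x_j Z_{ij} + (l/n) X_i X_j x_i x_j - (l/(2n)) x_i² x_j²`,
where `l` is the signal-to-noise ratio, `X` the signal and `Z` the noise. -/
def hamiltonian (l : ℝ) (n : ℕ) (X : Fin n → ℝ) (Z : Pairs n → ℝ) (x : Fin n → ℝ) : ℝ :=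
  ∑ p : Pairs n,
    (Real.sqrt (l / n) * x p.1.1 * x p.1.2 * Z p
      + l / n * X p.1.1 * X p.1.2 * x p.1.1 * x p.1.2
      - l / (2 * n) * x p.1.1 ^ 2 * x p.1.2 ^ 2)

/-- The partition function `∫ exp (H_n x) dP₀^{⊗n}(x)`. -/
def partition (P₀ : Measure ℝ) (l : ℝ) (n : ℕ) (X : Fin n → ℝ) (Z : Pairs n → ℝ) : ℝ :=
  ∫ x, Real.exp (hamiltonian l n X Z x) ∂(Measure.pi fun _ : Fin n => P₀)

/-- The joint law of signal and noise: `X_i` i.i.d. with law `P₀`, `Z_{ij}` (`i < j`) i.i.d.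
standard Gaussian, `X` and `Z` independent. -/
def jointLaw (P₀ : Measure ℝ) (n : ℕ) : Measure ((Fin n → ℝ) × (Pairs n → ℝ)) :=
  (Measure.pi fun _ : Fin n => P₀).prod (Measure.pi fun _ : Pairs n => gaussianReal 0 1)

/-- The free energy `F_n(l) = (1/n) E log 𝒵_n(l)`. -/
def freeEnergy (P₀ : Measure ℝ) (l : ℝ) (n : ℕ) : ℝ :=
  1 / n * ∫ w, Real.log (partition P₀ l n w.1 w.2) ∂(jointLaw P₀ n)

/-- The partition function of the scalar channel `Y = √g X + Z`:
`∫ exp (√g Z x + g x X - (g/2) x²) dP₀(x)`. -/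
def scalarPartition (P₀ : Measure ℝ) (g X Z : ℝ) : ℝ :=
  ∫ x, Real.exp (Real.sqrt g * Z * x + g * x * X - g / 2 * x ^ 2) ∂P₀

/-- The free energy `ψ_{P₀}(g)` of the scalar channel, with `X ∼ P₀` and `Z ∼ N(0,1)`
independent. -/
def scalarFreeEnergy (P₀ : Measure ℝ) (g : ℝ) : ℝ :=
  ∫ w : ℝ × ℝ, Real.log (scalarPartition P₀ g w.1 w.2) ∂(P₀.prod (gaussianReal 0 1))

/-- The potential `𝓕(l, q) = ψ_{P₀}(l q) - (l/4) q²`. -/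
def potential (P₀ : Measure ℝ) (l q : ℝ) : ℝ :=
  scalarFreeEnergy P₀ (l * q) - l / 4 * q ^ 2

end SpikedWigner

end

/-!
The bound is obtained by Guerra interpolation between the spiked Wigner model and `n` independent
scalar channels, written as a comparison inequality for Gaussian processes.

Both models are Gaussian channels: one observes `u x + G`, where `x` has a finitely supported law
and `G` is standard Gaussian noise. Let `Z(G) = ∑ p(a) exp (⟨u a, G⟩ - |u a|²/2)` be the density
of the observation relative to pure noise. The log-partition function at the observation is
`log Z(u x + G)`, so by the Cameron–Martin formula its mean is the relative entropy
`E[Z(G) log Z(G)]`, in which the signal `x` no longer appears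
(`integral_log_channelPartition`). This step plays the part of the Nishimori identity.

Since `z log z` is convex, `E[Z log Z]` is monotone in the covariance `⟨u a, u b⟩`, as in Kahane's
inequality: along a path `u_t`, Gaussian integration by parts gives the derivative
`E[∑ W_a W_b ⟨u_t' a, u_t b⟩ / Z]` with weights `W_a ≥ 0` summing to `Z`
(`hasDerivAt_relEntropy`). If the covariance of `v` is at least that of `w` minus `c`, the path
from `w` to `v` therefore loses at most `c / 2`, because `E Z = 1` (`relEntropy_sub_le`).

For `v a = √(l/n) (a_i a_j)_{i<j}` and `w a = √(l q) (a_i)_i`, with `R = ∑ a_i b_i`, the difference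
of the covariances is `(l/2n) (R - n q)² - l n q²/2 - (l/2n) ∑ a_i² b_i²`, hence at least
`-(l n q²/2) - O(1)` (`covariance_le`). As the relative entropy of `w` is `n` times the scalar
free energy, division by `n` yields `F_n(l) ≥ 𝓕(l, q) - O(1/n)`
(`potential_sub_le_freeEnergy`).
-/

namespace SpikedWigner

/-! ### Standard Gaussian vectors -/

section Gaussian

variable {I : Type*} [Fintype I]

/-- The standard Gaussian measure on `I → ℝ`. -/
noncomputable abbrev stdGauss (I : Type*) [Fintype I] : Measure (I → ℝ) :=
  Measure.pi fun _ : I => gaussianReal 0 1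

/-- Resampling one coordinate leaves the standard Gaussian measure invariant. -/
lemma measurePreserving_update [DecidableEq I] (k : I) :
    MeasurePreserving (fun w : (I → ℝ) × ℝ => Function.update w.1 k w.2)
      ((stdGauss I).prod (gaussianReal 0 1)) (stdGauss I) := by
  have hm : Measurable (fun w : (I → ℝ) × ℝ => Function.update w.1 k w.2) := by
    rw [measurable_pi_iff]
    intro i
    by_cases h : i = k
    · subst h; simpa using measurable_snd
    · simp only [Function.update_of_ne h]
      exact (measurable_pi_apply i).comp measurable_fst
  refine ⟨hm, (Measure.pi_eq fun s hs => ?_).symm⟩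
  rw [Measure.map_apply hm (MeasurableSet.univ_pi hs)]
  have hpre : (fun w : (I → ℝ) × ℝ => Function.update w.1 k w.2) ⁻¹' Set.univ.pi s
      = (Set.univ.pi (Function.update s k Set.univ)) ×ˢ s k := by
    ext w
    simp only [Set.mem_preimage, Set.mem_univ_pi, Set.mem_prod]
    constructor
    · intro h
      refine ⟨fun i => ?_, by simpa using h k⟩
      by_cases hi : i = k
      · subst hi; simp
      · simpa [Function.update_of_ne hi] using h i
    · rintro ⟨h, hk⟩ i
      by_cases hi : i = k
      · subst hi; simpa using hk
      · simpa [Function.update_of_ne hi] using h i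
  rw [hpre, Measure.prod_prod, Measure.pi_pi,
    ← Finset.mul_prod_erase Finset.univ (fun i => gaussianReal 0 1 (s i)) (Finset.mem_univ k),
    ← Finset.mul_prod_erase Finset.univ _ (Finset.mem_univ k)]
  simp only [Function.update_self, measure_univ, one_mul]
  rw [mul_comm]
  congr 1
  refine Finset.prod_congr rfl fun i hi => ?_
  rw [Function.update_of_ne (Finset.ne_of_mem_erase hi)]

lemma hasDerivAt_gaussianPDFReal (x : ℝ) :
    HasDerivAt (gaussianPDFReal 0 1) (-(x * gaussianPDFReal 0 1 x)) x := by
  rw [gaussianPDFReal_def]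
  have h : HasDerivAt (fun x : ℝ => -(x - 0) ^ 2 / (2 * ((1 : NNReal) : ℝ))) (-x) x := by
    have := (((hasDerivAt_id x).sub_const 0).pow 2).neg.div_const (2 * ((1 : NNReal) : ℝ))
    refine this.congr_deriv ?_
    simp
    ring
  refine (h.exp.const_mul _).congr_deriv ?_
  ring

lemma integrable_gaussianReal_iff {F : ℝ → ℝ} :
    Integrable F (gaussianReal 0 1) ↔ Integrable (fun x => gaussianPDFReal 0 1 x * F x) := by
  rw [gaussianReal_of_var_ne_zero _ one_ne_zero,
    integrable_withDensity_iff_integrable_smul' (measurable_gaussianPDF 0 1)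
      (ae_of_all _ fun _ => gaussianPDF_lt_top)]
  simp only [toReal_gaussianPDF, smul_eq_mul]

/-- Gaussian integration by parts (Stein's identity) in dimension one. -/
lemma integral_id_mul_gaussianReal {F F' : ℝ → ℝ} (hF : ∀ x, HasDerivAt F (F' x) x)
    (h0 : Integrable F (gaussianReal 0 1)) (h1 : Integrable F' (gaussianReal 0 1))
    (h2 : Integrable (fun x => x * F x) (gaussianReal 0 1)) :
    ∫ x, x * F x ∂(gaussianReal 0 1) = ∫ x, F' x ∂(gaussianReal 0 1) := by
  rw [integrable_gaussianReal_iff] at h0 h1 h2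
  rw [integral_gaussianReal_eq_integral_smul one_ne_zero,
    integral_gaussianReal_eq_integral_smul one_ne_zero]
  simp only [smul_eq_mul]
  have := integral_mul_deriv_eq_deriv_mul_of_integrable (u := gaussianPDFReal 0 1) (v := F)
    (u' := fun x => -(x * gaussianPDFReal 0 1 x)) (v' := F')
    (fun x _ => hasDerivAt_gaussianPDFReal x) (fun x _ => hF x) h1
    (by refine h2.neg.congr (ae_of_all _ fun x => ?_)
        simp only [Pi.neg_apply, Pi.mul_apply]; ring)
    h0
  rw [this, ← integral_neg]
  congr 1
  ext x
  ring

/-- Gaussian integration by parts in the coordinate `k`. -/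
lemma integral_coord_mul_stdGauss [DecidableEq I] (k : I) {F F' : (I → ℝ) → ℝ}
    (hF : ∀ G x, HasDerivAt (fun x => F (Function.update G k x)) (F' (Function.update G k x)) x)
    (h0 : Integrable F (stdGauss I)) (h1 : Integrable F' (stdGauss I))
    (h2 : Integrable (fun G => G k * F G) (stdGauss I)) :
    ∫ G, G k * F G ∂(stdGauss I) = ∫ G, F' G ∂(stdGauss I) := by
  have mp := measurePreserving_update (I := I) k
  have key : ∀ {H : (I → ℝ) → ℝ}, Integrable H (stdGauss I) →
      Integrable (fun w : (I → ℝ) × ℝ => H (Function.update w.1 k w.2))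
        ((stdGauss I).prod (gaussianReal 0 1)) :=
    fun hH => mp.integrable_comp_of_integrable hH
  have key2 : ∀ {H : (I → ℝ) → ℝ}, Integrable H (stdGauss I) →
      ∫ G, H G ∂(stdGauss I) =
        ∫ G, ∫ x, H (Function.update G k x) ∂(gaussianReal 0 1) ∂(stdGauss I) := by
    intro H hH
    rw [← integral_prod _ (key hH), ← integral_map mp.measurable.aemeasurable, mp.map_eq]
    rw [mp.map_eq]; exact hH.aestronglyMeasurable
  rw [key2 h2, key2 h1]
  refine integral_congr_ae ?_
  filter_upwards [(key h0).prod_right_ae, (key h1).prod_right_ae, (key h2).prod_right_ae]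
    with G g0 g1 g2
  simp only [Function.update_self] at g2 ⊢
  exact integral_id_mul_gaussianReal (hF G) g0 g1 g2

lemma integrable_exp_mul_abs (M : ℝ) :
    Integrable (fun x => Real.exp (M * |x|)) (gaussianReal 0 1) := by
  refine ((integrable_exp_mul_gaussianReal (μ := 0) (v := 1) M).add
    (integrable_exp_mul_gaussianReal (μ := 0) (v := 1) (-M))).mono'
    (by fun_prop) (ae_of_all _ fun x => ?_)
  rw [Real.norm_eq_abs, abs_of_pos (Real.exp_pos _)]
  simp only [Pi.add_apply]
  rcases abs_cases x with ⟨h, _⟩ | ⟨h, _⟩ <;> rw [h]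
  · linarith [Real.exp_pos (-M * x)]
  · rw [show M * -x = -M * x by ring]; linarith [Real.exp_pos (M * x)]

lemma integrable_exp_sum_abs (M C : ℝ) :
    Integrable (fun G : I → ℝ => Real.exp (M * ∑ k, |G k| + C)) (stdGauss I) := by
  have := (Integrable.fintype_prod (ι := I) (μ := fun _ => gaussianReal 0 1)
    (f := fun _ x => Real.exp (M * |x|)) fun _ => integrable_exp_mul_abs M).mul_const (Real.exp C)
  refine this.congr (ae_of_all _ fun G => ?_)
  simp only [← Real.exp_sum, ← Real.exp_add, Finset.mul_sum]

lemma gaussianPDFReal_translate (c x : ℝ) :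
    gaussianPDFReal 0 1 x * Real.exp (c * x - c ^ 2 / 2) = gaussianPDFReal c 1 x := by
  simp only [gaussianPDFReal_def, mul_assoc, ← Real.exp_add]
  congr 2
  simp
  ring

/-- The Cameron–Martin formula on `I → ℝ`. -/
lemma map_add_stdGauss (c : I → ℝ) :
    (stdGauss I).map (fun G => G + c) = (stdGauss I).withDensity
      (fun G => ENNReal.ofReal (∏ k, Real.exp (c k * G k - c k ^ 2 / 2))) := by
  have h1 : (stdGauss I).map (fun G => G + c) = Measure.pi fun k => gaussianReal (c k) 1 := by
    have := Measure.pi_map_pi (μ := fun _ : I => gaussianReal 0 1) (f := fun k x => x + c k)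
      (hμ := fun i => by rw [gaussianReal_map_add_const]; infer_instance) (fun i => by fun_prop)
    simp only [gaussianReal_map_add_const, zero_add] at this
    exact this
  rw [h1]
  refine Measure.pi_eq fun s hs => ?_
  have hint : ∀ k, Integrable ((s k).indicator fun x => Real.exp (c k * x - c k ^ 2 / 2))
      (gaussianReal 0 1) := fun k => by
    refine Integrable.indicator ?_ (hs k)
    simp only [Real.exp_sub]
    exact (integrable_exp_mul_gaussianReal (c k)).div_const _
  rw [withDensity_apply _ (MeasurableSet.univ_pi hs),
    ← lintegral_indicator (MeasurableSet.univ_pi hs)]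
  have hind : ∀ G : I → ℝ, (Set.univ.pi s).indicator
      (fun G : I → ℝ => ENNReal.ofReal (∏ k, Real.exp (c k * G k - c k ^ 2 / 2))) G =
      ENNReal.ofReal (∏ k, (s k).indicator (fun x => Real.exp (c k * x - c k ^ 2 / 2)) (G k)) := by
    intro G
    by_cases h : G ∈ Set.univ.pi s
    · rw [Set.indicator_of_mem h]
      congr 1
      exact Finset.prod_congr rfl fun k _ => (Set.indicator_of_mem (h k trivial)
        fun x => Real.exp (c k * x - c k ^ 2 / 2)).symm
    · rw [Set.indicator_of_notMem h]
      simp only [Set.mem_univ_pi, not_forall] at h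
      obtain ⟨k, hk⟩ := h
      rw [Finset.prod_eq_zero (Finset.mem_univ k) (Set.indicator_of_notMem hk _)]
      simp
  have hnn : ∀ k x, 0 ≤ (s k).indicator (fun x => Real.exp (c k * x - c k ^ 2 / 2)) x :=
    fun k x => Set.indicator_nonneg (fun _ _ => (Real.exp_pos _).le) x
  rw [lintegral_congr hind, ← ofReal_integral_eq_lintegral_ofReal
      (Integrable.fintype_prod_dep hint)
      (ae_of_all _ fun G => Finset.prod_nonneg fun k _ => hnn k _),
    integral_fintype_prod_eq_prod, ENNReal.ofReal_prod_of_nonneg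
      (fun k _ => integral_nonneg (hnn k))]
  refine Finset.prod_congr rfl fun k _ => ?_
  rw [gaussianReal_apply_eq_integral _ one_ne_zero,
    integral_gaussianReal_eq_integral_smul one_ne_zero, ← integral_indicator (hs k)]
  congr 2
  ext x
  by_cases h : x ∈ s k
  · simp [h, gaussianPDFReal_translate]
  · simp [h]

lemma integral_comp_add_stdGauss (c : I → ℝ) (F : (I → ℝ) → ℝ) :
    ∫ G, F (G + c) ∂(stdGauss I) =
      ∫ G, Real.exp (∑ k, c k * G k - (∑ k, c k ^ 2) / 2) * F G ∂(stdGauss I) := by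
  have hme : MeasurableEmbedding (fun G : I → ℝ => G + c) :=
    (MeasurableEquiv.addRight c).measurableEmbedding
  have hm : Measurable fun G : I → ℝ => ∏ k, Real.exp (c k * G k - c k ^ 2 / 2) := by fun_prop
  rw [← hme.integral_map, map_add_stdGauss,
    integral_withDensity_eq_integral_toReal_smul (by fun_prop) (ae_of_all _ fun _ => by simp)]
  congr 1
  ext G
  rw [ENNReal.toReal_ofReal (Finset.prod_nonneg fun k _ => (Real.exp_pos _).le), ← Real.exp_sum,
    Finset.sum_sub_distrib, Finset.sum_div, smul_eq_mul]

end Gaussian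

/-! ### Relative entropy and comparison of covariances -/

section Kahane

variable {A I : Type*} [Fintype I]

/-- The weight `p a * exp (⟨u a, G⟩ - |u a|² / 2)` of the signal `a`: its prior probability times
the likelihood ratio, against pure noise, of the observation `G` of `u a` in standard Gaussian
noise. -/
noncomputable def weight (p : A → ℝ) (u : A → I → ℝ) (G : I → ℝ) (a : A) : ℝ :=
  p a * Real.exp (∑ k, u a k * G k - (∑ k, u a k ^ 2) / 2)

lemma integrable_of_abs_le_exp {H : (I → ℝ) → ℝ} (hH : Measurable H) (B M C : ℝ)
    (h : ∀ G, |H G| ≤ B * Real.exp (M * ∑ k, |G k| + C)) : Integrable H (stdGauss I) :=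
  ((integrable_exp_sum_abs M C).const_mul B).mono' hH.aestronglyMeasurable (ae_of_all _ h)

@[fun_prop]
lemma measurable_weight (p : A → ℝ) (u : A → I → ℝ) (a : A) :
    Measurable fun G => weight p u G a := by
  unfold weight; fun_prop

variable {p : A → ℝ} {u : A → I → ℝ} {M : ℝ}

lemma abs_sum_mul_le {x : I → ℝ} (hx : ∀ k, |x k| ≤ M) (G : I → ℝ) :
    |∑ k, x k * G k| ≤ M * ∑ k, |G k| := by
  rw [Finset.mul_sum]
  refine (Finset.abs_sum_le_sum_abs _ _).trans (Finset.sum_le_sum fun k _ => ?_)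
  rw [abs_mul]
  exact mul_le_mul_of_nonneg_right (hx k) (abs_nonneg _)

lemma abs_sum_mul_le_card {x y : I → ℝ} (hx : ∀ k, |x k| ≤ M) (hy : ∀ k, |y k| ≤ M) :
    |∑ k, x k * y k| ≤ Fintype.card I * M ^ 2 := by
  refine (Finset.abs_sum_le_sum_abs _ _).trans ?_
  rw [← nsmul_eq_mul, ← Finset.card_univ]
  refine Finset.sum_le_card_nsmul _ _ _ fun k _ => ?_
  rw [abs_mul, pow_two]
  exact mul_le_mul (hx k) (hy k) (abs_nonneg _) ((abs_nonneg _).trans (hx k))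

lemma weight_nonneg (hp : ∀ a, 0 ≤ p a) (G : I → ℝ) (a : A) : 0 ≤ weight p u G a :=
  mul_nonneg (hp a) (Real.exp_pos _).le

lemma weight_le (hp : ∀ a, 0 ≤ p a) (hu : ∀ a k, |u a k| ≤ M) (G : I → ℝ) (a : A) :
    weight p u G a ≤ p a * Real.exp (M * ∑ k, |G k|) := by
  refine mul_le_mul_of_nonneg_left (Real.exp_le_exp.2 ?_) (hp a)
  have h1 := (le_abs_self _).trans (abs_sum_mul_le (hu a) G)
  have h2 : 0 ≤ ∑ k, u a k ^ 2 := Finset.sum_nonneg fun k _ => sq_nonneg _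
  linarith

lemma hasDerivAt_weight_update [DecidableEq I] (u : A → I → ℝ) (a : A) (k : I) (G : I → ℝ)
    (x : ℝ) : HasDerivAt (fun x => weight p u (Function.update G k x) a)
      (u a k * weight p u (Function.update G k x) a) x := by
  have h : HasDerivAt (fun x => ∑ j, u a j * Function.update G k x j - (∑ j, u a j ^ 2) / 2)
      (u a k) x := by
    have h1 : ∀ j ∈ Finset.univ, HasDerivAt (fun x => u a j * Function.update G k x j)
        (if j = k then u a k else 0) x := by
      intro j _
      by_cases hj : j = k
      · subst hj; simpa using (hasDerivAt_id x).const_mul (u a j)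
      · simpa [hj, Function.update_of_ne hj] using hasDerivAt_const x (u a j * G j)
    refine ((HasDerivAt.fun_sum h1).sub_const _).congr_deriv ?_
    simp
  refine (h.exp.const_mul (p a)).congr_deriv ?_
  simp only [weight]
  ring

lemma integral_weight (u : A → I → ℝ) (a : A) :
    ∫ G, weight p u G a ∂(stdGauss I) = p a := by
  have := integral_comp_add_stdGauss (u a) fun _ => (1 : ℝ)
  simp only [integral_const, probReal_univ, smul_eq_mul, mul_one] at this
  simp only [weight, integral_const_mul, ← this, mul_one]

lemma integrable_weight (hp : ∀ a, 0 ≤ p a) {u : A → I → ℝ} {M : ℝ} (hu : ∀ a k, |u a k| ≤ M)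
    (a : A) : Integrable (fun G => weight p u G a) (stdGauss I) := by
  refine integrable_of_abs_le_exp (by fun_prop) (p a) M 0 fun G => ?_
  rw [abs_of_nonneg (weight_nonneg hp G a), add_zero]
  exact weight_le hp hu G a

variable [Fintype A]

/-- The sum of all weights, which is the density of the observation relative to pure noise. -/
noncomputable def totalWeight (p : A → ℝ) (u : A → I → ℝ) (G : I → ℝ) : ℝ :=
  ∑ a, weight p u G a

/-- The relative entropy `E[Z log Z]` of the observation relative to pure noise, where `Z` is the
total weight. -/
noncomputable def relEntropy (p : A → ℝ) (u : A → I → ℝ) : ℝ :=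
  ∫ G, totalWeight p u G * Real.log (totalWeight p u G) ∂(stdGauss I)

@[fun_prop]
lemma measurable_totalWeight (p : A → ℝ) (u : A → I → ℝ) :
    Measurable fun G => totalWeight p u G := by
  unfold totalWeight; fun_prop

lemma totalWeight_le (hp : ∀ a, 0 ≤ p a) (hp1 : ∑ a, p a = 1) (hu : ∀ a k, |u a k| ≤ M)
    (G : I → ℝ) : totalWeight p u G ≤ Real.exp (M * ∑ k, |G k|) := by
  calc totalWeight p u G ≤ ∑ a, p a * Real.exp (M * ∑ k, |G k|) :=
        Finset.sum_le_sum fun a _ => weight_le hp hu G a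
    _ = _ := by rw [← Finset.sum_mul, hp1, one_mul]

lemma le_totalWeight (hp : ∀ a, 0 ≤ p a) (hp1 : ∑ a, p a = 1) (hu : ∀ a k, |u a k| ≤ M)
    (G : I → ℝ) :
    Real.exp (-(M * ∑ k, |G k| + Fintype.card I * M ^ 2)) ≤ totalWeight p u G := by
  calc _ = ∑ a, p a * Real.exp (-(M * ∑ k, |G k| + Fintype.card I * M ^ 2)) := by
        rw [← Finset.sum_mul, hp1, one_mul]
    _ ≤ _ := by
        refine Finset.sum_le_sum fun a _ =>
          mul_le_mul_of_nonneg_left (Real.exp_le_exp.2 ?_) (hp a)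
        have h1 := (neg_abs_le _).trans' (neg_le_neg (abs_sum_mul_le (hu a) G))
        have h2 := (le_abs_self _).trans (abs_sum_mul_le_card (hu a) (hu a))
        simp only [← pow_two] at h2
        have h3 : (0 : ℝ) ≤ Fintype.card I * M ^ 2 := by positivity
        linarith

lemma totalWeight_pos (hp : ∀ a, 0 ≤ p a) (hp1 : ∑ a, p a = 1) (u : A → I → ℝ) (G : I → ℝ) :
    0 < totalWeight p u G := by
  refine Finset.sum_pos' (fun a _ => weight_nonneg hp G a) ?_
  obtain ⟨a, ha, h⟩ := Finset.exists_ne_zero_of_sum_ne_zero (hp1.symm ▸ one_ne_zero : ∑ a, p a ≠ 0)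
  exact ⟨a, ha, mul_pos ((hp a).lt_of_ne' h) (Real.exp_pos _)⟩

lemma abs_log_totalWeight_le (hp : ∀ a, 0 ≤ p a) (hp1 : ∑ a, p a = 1)
    (hu : ∀ a k, |u a k| ≤ M) (G : I → ℝ) :
    |Real.log (totalWeight p u G)| ≤ M * ∑ k, |G k| + Fintype.card I * M ^ 2 := by
  have h3 : (0 : ℝ) ≤ Fintype.card I * M ^ 2 := by positivity
  rw [abs_le]
  constructor
  · rw [← Real.log_exp (-_)]
    exact Real.log_le_log (Real.exp_pos _) (le_totalWeight hp hp1 hu G)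
  · have := Real.log_le_log (totalWeight_pos hp hp1 u G) (totalWeight_le hp hp1 hu G)
    rw [Real.log_exp] at this
    linarith

lemma integrable_totalWeight_mul_log (hp : ∀ a, 0 ≤ p a) (hp1 : ∑ a, p a = 1)
    (hu : ∀ a k, |u a k| ≤ M) :
    Integrable (fun G => totalWeight p u G * Real.log (totalWeight p u G)) (stdGauss I) := by
  refine integrable_of_abs_le_exp (by fun_prop) 1 (2 * M) (Fintype.card I * M ^ 2) fun G => ?_
  rw [abs_mul, abs_of_pos (totalWeight_pos hp hp1 u G), one_mul]
  refine (mul_le_mul (totalWeight_le hp hp1 hu G)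
    ((abs_log_totalWeight_le hp hp1 hu G).trans ((le_add_of_nonneg_right zero_le_one).trans
      (Real.add_one_le_exp _))) (abs_nonneg _) (Real.exp_pos _).le).trans_eq ?_
  rw [← Real.exp_add]
  congr 1
  ring

/-- The derivative of `z log z` at the total weight, multiplied by a weight: the functional that
Gaussian integration by parts is applied to. -/
noncomputable def tiltedWeight (p : A → ℝ) (u : A → I → ℝ) (a : A) (G : I → ℝ) : ℝ :=
  weight p u G a * (Real.log (totalWeight p u G) + 1)

lemma abs_tiltedWeight_le (hp : ∀ a, 0 ≤ p a) (hp1 : ∑ a, p a = 1)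
    (hu : ∀ a k, |u a k| ≤ M) (a : A) (G : I → ℝ) :
    |tiltedWeight p u a G| ≤
      p a * Real.exp (2 * M * ∑ k, |G k| + (Fintype.card I * M ^ 2 + 1)) := by
  have h1 : |Real.log (totalWeight p u G) + 1| ≤
      Real.exp (M * ∑ k, |G k| + Fintype.card I * M ^ 2 + 1) := by
    refine (abs_add_le _ _).trans ?_
    rw [abs_one]
    have := abs_log_totalWeight_le hp hp1 hu G
    have := Real.add_one_le_exp (M * ∑ k, |G k| + Fintype.card I * M ^ 2 + 1)
    linarith
  rw [tiltedWeight, abs_mul, abs_of_nonneg (weight_nonneg hp G a)]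
  refine (mul_le_mul (weight_le hp hu G a) h1 (abs_nonneg _)
    (mul_nonneg (hp a) (Real.exp_pos _).le)).trans_eq ?_
  rw [mul_assoc, ← Real.exp_add]
  congr 2
  ring

lemma measurable_tiltedWeight (p : A → ℝ) (u : A → I → ℝ) (a : A) :
    Measurable (tiltedWeight p u a) := by
  unfold tiltedWeight; fun_prop

lemma integrable_tiltedWeight (hp : ∀ a, 0 ≤ p a) (hp1 : ∑ a, p a = 1)
    (hu : ∀ a k, |u a k| ≤ M) (a : A) : Integrable (tiltedWeight p u a) (stdGauss I) :=
  integrable_of_abs_le_exp (measurable_tiltedWeight p u a) _ _ _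
    (abs_tiltedWeight_le hp hp1 hu a)

lemma integrable_coord_mul_tiltedWeight (hp : ∀ a, 0 ≤ p a) (hp1 : ∑ a, p a = 1)
    (hu : ∀ a k, |u a k| ≤ M) (a : A) (k : I) :
    Integrable (fun G => G k * tiltedWeight p u a G) (stdGauss I) := by
  refine integrable_of_abs_le_exp ((measurable_pi_apply k).mul (measurable_tiltedWeight p u a))
    (p a) (2 * M + 1) (Fintype.card I * M ^ 2 + 1) fun G => ?_
  have h1 : |G k| ≤ Real.exp (∑ k, |G k|) := by
    have := Finset.single_le_sum (f := fun k => |G k|) (fun k _ => abs_nonneg _)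
      (Finset.mem_univ k)
    have := Real.add_one_le_exp (∑ k, |G k|)
    linarith
  rw [abs_mul]
  refine (mul_le_mul h1 (abs_tiltedWeight_le hp hp1 hu a G) (abs_nonneg _)
    (Real.exp_pos _).le).trans_eq ?_
  rw [mul_left_comm, ← Real.exp_add]
  congr 2
  ring

lemma integrable_weight_mul_div (hp : ∀ a, 0 ≤ p a) (hp1 : ∑ a, p a = 1)
    (hu : ∀ a k, |u a k| ≤ M) (a : A) (k : I) :
    Integrable (fun G => weight p u G a * (∑ b, u b k * weight p u G b) / totalWeight p u G)
      (stdGauss I) := by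
  refine integrable_of_abs_le_exp (by fun_prop) (p a * M) M 0 fun G => ?_
  have hZ := totalWeight_pos hp hp1 u G
  have h1 : |∑ b, u b k * weight p u G b| ≤ M * totalWeight p u G := by
    rw [totalWeight, Finset.mul_sum]
    refine (Finset.abs_sum_le_sum_abs _ _).trans (Finset.sum_le_sum fun b _ => ?_)
    rw [abs_mul, abs_of_nonneg (weight_nonneg hp G b)]
    exact mul_le_mul_of_nonneg_right (hu b k) (weight_nonneg hp G b)
  rw [abs_div, abs_of_pos hZ, div_le_iff₀ hZ, abs_mul, abs_of_nonneg (weight_nonneg hp G a),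
    add_zero]
  refine (mul_le_mul (weight_le hp hu G a) h1 (abs_nonneg _)
    (mul_nonneg (hp a) (Real.exp_pos _).le)).trans_eq ?_
  ring

/-- Gaussian integration by parts for the functional `tiltedWeight`. -/
lemma integral_coord_mul_tiltedWeight (hp : ∀ a, 0 ≤ p a) (hp1 : ∑ a, p a = 1)
    {u : A → I → ℝ} {M : ℝ} (hu : ∀ a k, |u a k| ≤ M) (a : A) (k : I) :
    ∫ G, G k * tiltedWeight p u a G ∂(stdGauss I) =
      u a k * ∫ G, tiltedWeight p u a G ∂(stdGauss I) +
      ∫ G, weight p u G a * (∑ b, u b k * weight p u G b) / totalWeight p u G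
        ∂(stdGauss I) := by
  classical
  have i1 := (integrable_tiltedWeight hp hp1 hu a).const_mul (u a k)
  have i2 := integrable_weight_mul_div hp hp1 hu a k
  rw [integral_coord_mul_stdGauss k (F' := fun G => u a k * tiltedWeight p u a G +
      weight p u G a * (∑ b, u b k * weight p u G b) / totalWeight p u G) ?_
      (integrable_tiltedWeight hp hp1 hu a) (i1.add i2)
      (integrable_coord_mul_tiltedWeight hp hp1 hu a k),
    integral_add i1 i2, integral_const_mul]
  intro G x
  have hZ := totalWeight_pos hp hp1 u (Function.update G k x)
  have h1 : HasDerivAt (fun x => totalWeight p u (Function.update G k x))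
      (∑ b, u b k * weight p u (Function.update G k x) b) x :=
    HasDerivAt.fun_sum fun b _ => hasDerivAt_weight_update u b k G x
  refine ((hasDerivAt_weight_update u a k G x).mul
    ((h1.log hZ.ne').add_const 1)).congr_deriv ?_
  simp only [tiltedWeight]
  ring

/-- The derivative of the relative entropy along a path of signals. Integration by parts leaves
`E[∑ W_a W_b ⟨u' a, u b⟩ / Z]`, written here with the sums over `a` and over coordinates taken
out of the expectation. -/
lemma hasDerivAt_relEntropy (hp : ∀ a, 0 ≤ p a) (hp1 : ∑ a, p a = 1)
    {u u' : ℝ → A → I → ℝ} {M : ℝ} (hu : ∀ t a k, |u t a k| ≤ M) (hu' : ∀ t a k, |u' t a k| ≤ M)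
    (hd : ∀ t a k, HasDerivAt (fun t => u t a k) (u' t a k) t) (t : ℝ) :
    HasDerivAt (fun t => relEntropy p (u t))
      (∑ a, ∑ k, u' t a k * ∫ G, weight p (u t) G a * (∑ b, u t b k * weight p (u t) G b) /
        totalWeight p (u t) G ∂(stdGauss I)) t := by
  set K : ℝ := Fintype.card I * M ^ 2 with hK
  let F' : ℝ → (I → ℝ) → ℝ := fun t G =>
    ∑ a, ∑ k, u' t a k * (G k * tiltedWeight p (u t) a G - u t a k * tiltedWeight p (u t) a G)
  have hmeas : Measurable (F' t) := by
    refine Finset.measurable_sum _ fun a _ => Finset.measurable_sum _ fun k _ => ?_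
    have := measurable_tiltedWeight p (u t) a
    fun_prop
  have hdiff : ∀ G s, HasDerivAt
      (fun s => totalWeight p (u s) G * Real.log (totalWeight p (u s) G)) (F' s G) s := by
    intro G s
    have hZ := totalWeight_pos hp hp1 (u s) G
    have hw : ∀ a, HasDerivAt (fun s => weight p (u s) G a)
        (weight p (u s) G a * ∑ k, u' s a k * (G k - u s a k)) s := by
      intro a
      have h1 : HasDerivAt (fun s => ∑ k, u s a k * G k - (∑ k, u s a k ^ 2) / 2)
          (∑ k, u' s a k * (G k - u s a k)) s := by
        refine ((HasDerivAt.fun_sum fun k _ => (hd s a k).mul_const (G k)).sub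
          ((HasDerivAt.fun_sum fun k _ => (hd s a k).pow 2).div_const 2)).congr_deriv ?_
        rw [Finset.sum_div, ← Finset.sum_sub_distrib]
        refine Finset.sum_congr rfl fun k _ => ?_
        simp
        ring
      refine (h1.exp.const_mul (p a)).congr_deriv ?_
      simp only [weight]
      ring
    have hZd : HasDerivAt (fun s => totalWeight p (u s) G)
        (∑ a, weight p (u s) G a * ∑ k, u' s a k * (G k - u s a k)) s :=
      HasDerivAt.fun_sum fun a _ => hw a
    refine (hZd.mul (hZd.log hZ.ne')).congr_deriv ?_
    rw [mul_div_cancel₀ _ hZ.ne', Finset.sum_mul, ← Finset.sum_add_distrib]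
    refine Finset.sum_congr rfl fun a _ => ?_
    simp only [tiltedWeight, Finset.mul_sum, Finset.sum_mul]
    rw [← Finset.sum_add_distrib]
    refine Finset.sum_congr rfl fun k _ => ?_
    ring
  have hbound : ∀ G s, ‖F' s G‖ ≤ Real.exp (3 * M * ∑ k, |G k| + (2 * K + 1)) := by
    intro G s
    have h1 : ∀ a, |∑ k, u' s a k * (G k - u s a k)| ≤ Real.exp (M * ∑ k, |G k| + K) := by
      intro a
      have e1 := abs_sum_mul_le (hu' s a) G
      have e2 := abs_sum_mul_le_card (hu' s a) (hu s a)
      have e3 := Real.add_one_le_exp (M * ∑ k, |G k| + K)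
      simp only [mul_sub, Finset.sum_sub_distrib]
      have := abs_sub (∑ k, u' s a k * G k) (∑ k, u' s a k * u s a k)
      linarith
    have h2 : F' s G = ∑ a, tiltedWeight p (u s) a G * ∑ k, u' s a k * (G k - u s a k) := by
      refine Finset.sum_congr rfl fun a _ => ?_
      rw [Finset.mul_sum]
      refine Finset.sum_congr rfl fun k _ => ?_
      ring
    rw [h2, Real.norm_eq_abs]
    calc _ ≤ ∑ a, p a * (Real.exp (2 * M * ∑ k, |G k| + (K + 1)) *
          Real.exp (M * ∑ k, |G k| + K)) := by
          refine (Finset.abs_sum_le_sum_abs _ _).trans (Finset.sum_le_sum fun a _ => ?_)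
          rw [abs_mul, ← mul_assoc]
          exact mul_le_mul (abs_tiltedWeight_le hp hp1 (hu s) a G) (h1 a) (abs_nonneg _)
            (mul_nonneg (hp a) (Real.exp_pos _).le)
      _ = _ := by
          rw [← Finset.sum_mul, hp1, one_mul, ← Real.exp_add]
          congr 1
          ring
  have main := (hasDerivAt_integral_of_dominated_loc_of_deriv_le (μ := stdGauss I) (s := Set.univ)
    (x₀ := t) (F := fun s G => totalWeight p (u s) G * Real.log (totalWeight p (u s) G)) (F' := F')
    (bound := fun G => Real.exp (3 * M * ∑ k, |G k| + (2 * K + 1))) univ_mem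
    (Eventually.of_forall fun s => by fun_prop)
    (integrable_totalWeight_mul_log hp hp1 (hu t)) hmeas.aestronglyMeasurable
    (ae_of_all _ fun G s _ => hbound G s) (integrable_exp_sum_abs _ _)
    (ae_of_all _ fun G s _ => hdiff G s)).2
  refine main.congr_deriv ?_
  have i1 := fun a k => integrable_coord_mul_tiltedWeight hp hp1 (hu t) a k
  have i2 := fun a (k : I) => (integrable_tiltedWeight hp hp1 (hu t) a).const_mul (u t a k)
  have i3 : ∀ a k, Integrable (fun G => u' t a k *
      (G k * tiltedWeight p (u t) a G - u t a k * tiltedWeight p (u t) a G)) (stdGauss I) :=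
    fun a k => ((i1 a k).sub (i2 a k)).const_mul (u' t a k)
  simp only [F']
  rw [integral_finsetSum _ fun a _ => integrable_finsetSum _ fun k _ => i3 a k]
  refine Finset.sum_congr rfl fun a _ => ?_
  rw [integral_finsetSum _ fun k _ => i3 a k]
  refine Finset.sum_congr rfl fun k _ => ?_
  rw [integral_const_mul, integral_sub (i1 a k) (i2 a k), integral_const_mul,
    integral_coord_mul_tiltedWeight hp hp1 (hu t)]
  ring

/-- If `⟨u'(a), u(b)⟩ ≥ -s` for all `a`, `b`, then the derivative of the relative entropy is at
least `-s`. -/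
lemma neg_le_deriv_relEntropy (hp : ∀ a, 0 ≤ p a) (hp1 : ∑ a, p a = 1)
    {u u' : A → I → ℝ} {M : ℝ} (hu : ∀ a k, |u a k| ≤ M) {s : ℝ}
    (hs : ∀ a b, -s ≤ ∑ k, u' a k * u b k) :
    -s ≤ ∑ a, ∑ k, u' a k * ∫ G, weight p u G a * (∑ b, u b k * weight p u G b) /
        totalWeight p u G ∂(stdGauss I) := by
  have i1 := fun a k => (integrable_weight_mul_div hp hp1 hu a k).const_mul (u' a k)
  have hZ : ∫ G, -s * totalWeight p u G ∂(stdGauss I) = -s := by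
    simp only [integral_const_mul, totalWeight]
    rw [integral_finsetSum _ fun a _ => integrable_weight hp hu a]
    simp only [integral_weight, hp1, mul_one]
  simp only [← integral_const_mul]
  simp only [← integral_finsetSum _ fun k _ => i1 _ k]
  rw [← integral_finsetSum _ fun a _ => integrable_finsetSum _ fun k _ => i1 a k, ← hZ]
  refine integral_mono
    ((integrable_finsetSum _ fun a _ => integrable_weight hp hu a).const_mul (-s))
    (integrable_finsetSum _ fun a _ => integrable_finsetSum _ fun k _ => i1 a k) fun G => ?_
  have hZ := totalWeight_pos hp hp1 u G
  have e : ∑ a, ∑ k, u' a k * (weight p u G a * (∑ b, u b k * weight p u G b) /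
        totalWeight p u G) =
      (∑ a, ∑ b, weight p u G a * weight p u G b * ∑ k, u' a k * u b k) / totalWeight p u G := by
    rw [Finset.sum_div]
    refine Finset.sum_congr rfl fun a _ => ?_
    simp only [Finset.mul_sum, Finset.sum_div]
    rw [Finset.sum_comm]
    refine Finset.sum_congr rfl fun b _ => Finset.sum_congr rfl fun k _ => ?_
    ring
  simp only [e]
  rw [le_div_iff₀ hZ]
  calc -s * totalWeight p u G * totalWeight p u G
      = ∑ a, ∑ b, weight p u G a * weight p u G b * -s := by
        simp only [← Finset.sum_mul, ← Finset.mul_sum, totalWeight]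
        ring
    _ ≤ _ := Finset.sum_le_sum fun a _ => Finset.sum_le_sum fun b _ =>
        mul_le_mul_of_nonneg_left (hs a b)
          (mul_nonneg (weight_nonneg hp G a) (weight_nonneg hp G b))

variable {J : Type*} [Fintype J]

lemma relEntropy_sumElim_zero (v : A → I → ℝ) :
    relEntropy p (fun a => Sum.elim (v a) (fun _ : J => (0 : ℝ))) = relEntropy p v := by
  have mp : MeasurePreserving (fun (G : I ⊕ J → ℝ) i => G (Sum.inl i)) (stdGauss (I ⊕ J))
      (stdGauss I) :=
    measurePreserving_fst.comp
      (measurePreserving_sumPiEquivProdPi fun _ : I ⊕ J => gaussianReal 0 1)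
  unfold relEntropy
  rw [← mp.map_eq, integral_map mp.measurable.aemeasurable]
  · simp [totalWeight, weight]
  · exact Measurable.aestronglyMeasurable (by fun_prop)

lemma relEntropy_zero_sumElim (w : A → J → ℝ) :
    relEntropy p (fun a => Sum.elim (fun _ : I => (0 : ℝ)) (w a)) = relEntropy p w := by
  have mp : MeasurePreserving (fun (G : I ⊕ J → ℝ) i => G (Sum.inr i)) (stdGauss (I ⊕ J))
      (stdGauss J) :=
    measurePreserving_snd.comp
      (measurePreserving_sumPiEquivProdPi fun _ : I ⊕ J => gaussianReal 0 1)
  unfold relEntropy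
  rw [← mp.map_eq, integral_map mp.measurable.aemeasurable]
  · simp [totalWeight, weight]
  · exact Measurable.aestronglyMeasurable (by fun_prop)

/-- A Kahane-type comparison inequality: if the covariance of `v` dominates that of `w` entrywise
up to an additive constant `c`, then so do the relative entropies, up to `c / 2`. -/
theorem relEntropy_sub_le (hp : ∀ a, 0 ≤ p a) (hp1 : ∑ a, p a = 1) (v : A → I → ℝ)
    (w : A → J → ℝ) (c : ℝ) (hc : ∀ a b, ∑ k, w a k * w b k - c ≤ ∑ k, v a k * v b k) :
    relEntropy p w - c / 2 ≤ relEntropy p v := by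
  -- The trigonometric path is smooth up to its endpoints, which a path with weights
  -- `√t` and `√(1 - t)` is not.
  let u : ℝ → A → I ⊕ J → ℝ := fun t a =>
    Sum.elim (fun k => Real.sin t * v a k) (fun k => Real.cos t * w a k)
  let u' : ℝ → A → I ⊕ J → ℝ := fun t a =>
    Sum.elim (fun k => Real.cos t * v a k) (fun k => -Real.sin t * w a k)
  let M : ℝ := ∑ a, (∑ k, |v a k| + ∑ k, |w a k|)
  have hvM : ∀ a k, |v a k| ≤ M := fun a k => by
    have h1 := Finset.single_le_sum (f := fun k => |v a k|) (fun k _ => abs_nonneg _)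
      (Finset.mem_univ k)
    have h2 := Finset.single_le_sum (f := fun a => ∑ k, |v a k| + ∑ k, |w a k|)
      (fun a _ => by positivity) (Finset.mem_univ a)
    have h3 : 0 ≤ ∑ k, |w a k| := by positivity
    linarith
  have hwM : ∀ a k, |w a k| ≤ M := fun a k => by
    have h1 := Finset.single_le_sum (f := fun k => |w a k|) (fun k _ => abs_nonneg _)
      (Finset.mem_univ k)
    have h2 := Finset.single_le_sum (f := fun a => ∑ k, |v a k| + ∑ k, |w a k|)
      (fun a _ => by positivity) (Finset.mem_univ a)
    have h3 : 0 ≤ ∑ k, |v a k| := by positivity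
    linarith
  have hmul : ∀ {x y : ℝ}, |x| ≤ 1 → |y| ≤ M → |x * y| ≤ M := fun {x y} hx hy => by
    rw [abs_mul]
    exact (mul_le_of_le_one_left (abs_nonneg _) hx).trans hy
  have hu : ∀ t a k, |u t a k| ≤ M := by
    rintro t a (k | k)
    · exact hmul (Real.abs_sin_le_one t) (hvM a k)
    · exact hmul (Real.abs_cos_le_one t) (hwM a k)
  have hu' : ∀ t a k, |u' t a k| ≤ M := by
    rintro t a (k | k)
    · exact hmul (Real.abs_cos_le_one t) (hvM a k)
    · exact hmul (by rw [abs_neg]; exact Real.abs_sin_le_one t) (hwM a k)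
  have hd : ∀ t a k, HasDerivAt (fun t => u t a k) (u' t a k) t := by
    rintro t a (k | k)
    · exact (Real.hasDerivAt_sin t).mul_const _
    · exact (Real.hasDerivAt_cos t).mul_const _
  have hd1 := fun t => (hasDerivAt_relEntropy hp hp1 hu hu' hd t).add
    (((Real.hasDerivAt_sin t).pow 2).const_mul (c / 2))
  have hmono : MonotoneOn (fun t => relEntropy p (u t) + c / 2 * Real.sin t ^ 2)
      (Set.Icc 0 (Real.pi / 2)) := by
    refine monotoneOn_of_deriv_nonneg (convex_Icc _ _)
      (fun t _ => (hd1 t).continuousAt.continuousWithinAt)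
      (fun t _ => (hd1 t).differentiableAt.differentiableWithinAt) fun t ht => ?_
    rw [interior_Icc] at ht
    refine le_of_le_of_eq ?_ (hd1 t).deriv.symm
    have hsc : 0 ≤ Real.sin t * Real.cos t :=
      mul_nonneg (Real.sin_nonneg_of_nonneg_of_le_pi ht.1.le (by linarith [ht.2, Real.pi_pos]))
        (Real.cos_nonneg_of_neg_pi_div_two_le_of_le (by linarith [ht.1, Real.pi_pos]) ht.2.le)
    have := neg_le_deriv_relEntropy hp hp1 (u := u t) (u' := u' t) (hu t)
      (s := Real.sin t * Real.cos t * c) fun a b => by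
        have h1 : ∑ k, u' t a k * u t b k = Real.sin t * Real.cos t *
            (∑ k, v a k * v b k - ∑ k, w a k * w b k) := by
          simp only [u, u', Fintype.sum_sum_type, Sum.elim_inl, Sum.elim_inr]
          rw [mul_sub, Finset.mul_sum, Finset.mul_sum, sub_eq_add_neg, ← Finset.sum_neg_distrib]
          congr 1
          · exact Finset.sum_congr rfl fun k _ => by ring
          · exact Finset.sum_congr rfl fun k _ => by ring
        rw [h1, ← mul_neg]
        exact mul_le_mul_of_nonneg_left (by linarith [hc a b]) hsc
    simp only [Nat.cast_ofNat, Nat.add_one_sub_one, pow_one]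
    linarith
  have h01 := hmono (Set.left_mem_Icc.2 (by positivity)) (Set.right_mem_Icc.2 (by positivity))
    (by positivity : (0 : ℝ) ≤ Real.pi / 2)
  simp only [u, Real.sin_zero, Real.cos_zero, Real.sin_pi_div_two, Real.cos_pi_div_two, zero_mul,
    one_mul, relEntropy_sumElim_zero, relEntropy_zero_sumElim] at h01
  linarith

end Kahane

/-! ### Gaussian channels with finitely supported signal -/

section Channel

variable {X I : Type*} [Fintype I]

lemma exists_abs_le (u : X → I → ℝ) (T : Finset X) : ∃ M, ∀ (a : T) k, |u a k| ≤ M := by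
  refine ⟨∑ a : T, ∑ k, |u a k|, fun a k => ?_⟩
  exact (Finset.single_le_sum (f := fun k => |u a k|) (fun k _ => abs_nonneg _)
      (Finset.mem_univ k)).trans
    (Finset.single_le_sum (f := fun a : T => ∑ k, |u a k|)
      (fun a _ => Finset.sum_nonneg fun k _ => abs_nonneg _) (Finset.mem_univ a))

variable [MeasurableSpace X] {P : Measure X} {T : Finset X}

lemma restrict_eq_self_of_finset (hT : ∀ᵐ x ∂P, x ∈ T) : P.restrict (T : Set X) = P :=
  Measure.restrict_eq_self_of_ae_mem (by simpa using hT)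

variable [MeasurableSingletonClass X] [IsProbabilityMeasure P]

lemma integrable_of_finset (hT : ∀ᵐ x ∂P, x ∈ T) (f : X → ℝ) : Integrable f P := by
  have h := (integrableOn_finset_iUnion (s := T) (t := fun x => {x}) (f := f) (μ := P)).2
    fun x _ => integrableOn_singleton
  rwa [show ⋃ x ∈ T, {x} = (T : Set X) by ext; simp, IntegrableOn,
    restrict_eq_self_of_finset hT] at h

lemma integral_eq_sum_finset (hT : ∀ᵐ x ∂P, x ∈ T) (f : X → ℝ) :
    ∫ x, f x ∂P = ∑ x : T, P.real {(x : X)} * f x := by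
  have h := setIntegral_finset (μ := P) T (integrable_of_finset hT f).integrableOn
  rw [restrict_eq_self_of_finset hT] at h
  rw [h, ← Finset.sum_coe_sort]
  rfl

lemma sum_prior_eq_one (hT : ∀ᵐ x ∂P, x ∈ T) : ∑ x : T, P.real {(x : X)} = 1 := by
  have := integral_eq_sum_finset hT fun _ => (1 : ℝ)
  simpa using this.symm

/-- The partition function of the Gaussian channel which observes `u x + G`, where the signal `x`
has law `P` and `G` is standard Gaussian noise. -/
noncomputable def channelPartition (P : Measure X) (u : X → I → ℝ) (x : X) (G : I → ℝ) : ℝ :=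
  ∫ y, Real.exp (∑ k, u y k * G k + ∑ k, u y k * u x k - (∑ k, u y k ^ 2) / 2) ∂P

lemma channelPartition_eq_totalWeight (hT : ∀ᵐ x ∂P, x ∈ T) (u : X → I → ℝ) (x : X)
    (G : I → ℝ) :
    channelPartition P u x G =
      totalWeight (fun a : T => P.real {(a : X)}) (fun a => u a) (G + u x) := by
  rw [channelPartition, integral_eq_sum_finset hT]
  simp only [totalWeight, weight, Pi.add_apply, mul_add, Finset.sum_add_distrib]

lemma channelPartition_pos (hT : ∀ᵐ x ∂P, x ∈ T) (u : X → I → ℝ) (x : X) (G : I → ℝ) :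
    0 < channelPartition P u x G := by
  rw [channelPartition_eq_totalWeight hT]
  exact totalWeight_pos (fun _ => measureReal_nonneg) (sum_prior_eq_one hT) _ _

lemma integrable_log_channelPartition (hT : ∀ᵐ x ∂P, x ∈ T) {u : X → I → ℝ}
    (hu : ∀ k, Measurable fun x => u x k) :
    Integrable (fun w : X × (I → ℝ) => Real.log (channelPartition P u w.1 w.2))
      (P.prod (stdGauss I)) := by
  obtain ⟨M, hM⟩ := exists_abs_le u T
  set C : ℝ := Fintype.card I * M ^ 2 with hC
  have hb : Integrable (fun w : X × (I → ℝ) => Real.exp (M * ∑ k, |w.2 k| + 2 * C))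
      (P.prod (stdGauss I)) := (integrable_exp_sum_abs M (2 * C)).comp_snd P
  refine hb.mono' ?_ ?_
  · refine Measurable.aestronglyMeasurable ?_
    simp only [channelPartition, integral_eq_sum_finset hT]
    fun_prop
  · have hT' : ∀ᵐ w ∂(P.prod (stdGauss I)), w.1 ∈ T := Measure.quasiMeasurePreserving_fst.ae hT
    filter_upwards [hT'] with w hw
    have hp1 := sum_prior_eq_one hT
    rw [channelPartition_eq_totalWeight hT, Real.norm_eq_abs]
    refine (abs_log_totalWeight_le (fun _ => measureReal_nonneg) hp1 hM _).trans ?_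
    -- `M` may be negative when there are no coordinates, so that case is separate.
    rcases isEmpty_or_nonempty I with hI | ⟨⟨k0⟩⟩
    · simp only [Finset.univ_eq_empty, Finset.sum_empty, mul_zero, zero_add, ← hC]
      have : C = 0 := by simp [hC]
      rw [this]; positivity
    have hM0 : 0 ≤ M := (abs_nonneg _).trans (hM ⟨w.1, hw⟩ k0)
    have h1 : ∑ k, |(w.2 + u w.1) k| ≤ ∑ k, |w.2 k| + Fintype.card I * M := by
      refine (Finset.sum_le_sum fun k _ => (abs_add_le (w.2 k) (u w.1 k)).trans
        (add_le_add_right (hM ⟨w.1, hw⟩ k) _)).trans_eq ?_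
      rw [Finset.sum_add_distrib]
      simp
    have h2 := mul_le_mul_of_nonneg_left h1 hM0
    have h3 := Real.add_one_le_exp (M * ∑ k, |w.2 k| + 2 * C)
    have h4 : M * (∑ k, |w.2 k| + Fintype.card I * M) = M * ∑ k, |w.2 k| + C := by
      rw [hC]; ring
    linarith

/-- The mean log-partition function of a Gaussian channel is the relative entropy of its
observation: given the signal `x`, shifting the noise by `u x` multiplies the noise density by the
likelihood ratio of `x`, and averaging these ratios over `x` gives the partition function again. -/
lemma integral_log_channelPartition (hT : ∀ᵐ x ∂P, x ∈ T) {u : X → I → ℝ}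
    (hu : ∀ k, Measurable fun x => u x k) :
    ∫ w, Real.log (channelPartition P u w.1 w.2) ∂(P.prod (stdGauss I)) =
      relEntropy (fun a : T => P.real {(a : X)}) (fun a => u a) := by
  obtain ⟨M, hM⟩ := exists_abs_le u T
  have hp1 := sum_prior_eq_one hT
  have hp : ∀ a : T, 0 ≤ P.real {(a : X)} := fun _ => measureReal_nonneg
  rw [integral_prod _ (integrable_log_channelPartition hT hu), integral_eq_sum_finset hT]
  simp only [channelPartition_eq_totalWeight hT]
  have hint : ∀ a : T, Integrable (fun G => weight (fun a : T => P.real {(a : X)})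
      (fun a => u a) G a * Real.log (totalWeight (fun a : T => P.real {(a : X)})
      (fun a => u a) G)) (stdGauss I) := fun a => by
    refine ((integrable_tiltedWeight hp hp1 hM a).sub (integrable_weight hp hM a)).congr
      (ae_of_all _ fun G => ?_)
    simp only [Pi.sub_apply, tiltedWeight]
    ring
  have e : relEntropy (fun a : T => P.real {(a : X)}) (fun a => u a) =
      ∫ G, ∑ a : T, weight (fun a : T => P.real {(a : X)}) (fun a => u a) G a *
        Real.log (totalWeight (fun a : T => P.real {(a : X)}) (fun a => u a) G)
        ∂(stdGauss I) := by
    simp only [← Finset.sum_mul]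
    rfl
  rw [e, integral_finsetSum _ fun a _ => hint a]
  refine Finset.sum_congr rfl fun a _ => ?_
  rw [integral_comp_add_stdGauss (u a) fun G =>
    Real.log (totalWeight (fun a : T => P.real {(a : X)}) (fun a => u a) G), ← integral_const_mul]
  simp only [weight, mul_assoc]

end Channel

/-! ### The spiked Wigner model and the scalar channel -/

section Wigner

variable {P₀ : Measure ℝ}

/-- The signal `√(l/n) x_i x_j`, `i < j`, of the spiked Wigner model. -/
noncomputable def pairSignal (l : ℝ) (n : ℕ) (x : Fin n → ℝ) (p : Pairs n) : ℝ :=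
  Real.sqrt (l / n) * x p.1.1 * x p.1.2

lemma measurable_pairSignal (l : ℝ) (n : ℕ) (p : Pairs n) :
    Measurable fun x => pairSignal l n x p := by
  unfold pairSignal; fun_prop

lemma partition_eq_channelPartition {l : ℝ} (hl : 0 ≤ l) (n : ℕ) (X : Fin n → ℝ)
    (Z : Pairs n → ℝ) :
    partition P₀ l n X Z =
      channelPartition (Measure.pi fun _ : Fin n => P₀) (pairSignal l n) X Z := by
  have hs : Real.sqrt (l / n) ^ 2 = l / n := Real.sq_sqrt (by positivity)
  unfold partition channelPartition hamiltonian
  congr 1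
  ext x
  congr 1
  rw [Finset.sum_div, ← Finset.sum_add_distrib, ← Finset.sum_sub_distrib]
  refine Finset.sum_congr rfl fun p _ => ?_
  have e : l / (2 * n) = l / n / 2 := by rw [mul_comm, div_mul_eq_div_div]
  simp only [pairSignal]
  rw [e]
  linear_combination (x p.1.1 ^ 2 * x p.1.2 ^ 2 / 2 - x p.1.1 * x p.1.2 * X p.1.1 * X p.1.2) * hs

lemma scalarPartition_eq_channelPartition {g : ℝ} (hg : 0 ≤ g) (X Z : ℝ) :
    scalarPartition P₀ g X Z =
      channelPartition P₀ (fun x (_ : Unit) => Real.sqrt g * x) X fun _ => Z := by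
  have hs : Real.sqrt g ^ 2 = g := Real.sq_sqrt hg
  unfold scalarPartition channelPartition
  congr 1
  ext x
  congr 1
  simp only [Finset.univ_unique, Finset.sum_singleton]
  linear_combination (x ^ 2 / 2 - x * X) * hs

variable [IsProbabilityMeasure P₀] {S : Finset ℝ}

lemma ae_mem_piFinset (hS : ∀ᵐ x ∂P₀, x ∈ S) (n : ℕ) :
    ∀ᵐ x ∂(Measure.pi fun _ : Fin n => P₀), x ∈ Fintype.piFinset fun _ => S := by
  simp only [Fintype.mem_piFinset]
  exact ae_all_iff.2 fun i => (Measure.quasiMeasurePreserving_eval (fun _ : Fin n => P₀) i).ae hS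

lemma integrable_log_partition (hS : ∀ᵐ x ∂P₀, x ∈ S) {l : ℝ} (hl : 0 ≤ l) (n : ℕ) :
    Integrable (fun w : (Fin n → ℝ) × (Pairs n → ℝ) => Real.log (partition P₀ l n w.1 w.2))
      (jointLaw P₀ n) := by
  simp only [partition_eq_channelPartition hl]
  exact integrable_log_channelPartition (ae_mem_piFinset hS n) (measurable_pairSignal l n)

lemma scalarPartition_pos (hS : ∀ᵐ x ∂P₀, x ∈ S) {g : ℝ} (hg : 0 ≤ g) (X Z : ℝ) :
    0 < scalarPartition P₀ g X Z := by
  rw [scalarPartition_eq_channelPartition hg]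
  exact channelPartition_pos hS _ _ _

lemma integrable_log_scalarPartition (hS : ∀ᵐ x ∂P₀, x ∈ S) {g : ℝ} (hg : 0 ≤ g) :
    Integrable (fun w : ℝ × ℝ => Real.log (scalarPartition P₀ g w.1 w.2))
      (P₀.prod (gaussianReal 0 1)) := by
  have mp : MeasurePreserving (fun w : ℝ × ℝ => (w.1, fun _ : Unit => w.2))
      (P₀.prod (gaussianReal 0 1)) (P₀.prod (stdGauss Unit)) :=
    (MeasurePreserving.id P₀).prod
      (measurePreserving_funUnique (gaussianReal 0 1) Unit).symm
  simp only [scalarPartition_eq_channelPartition hg]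
  exact mp.integrable_comp_of_integrable
    (integrable_log_channelPartition hS (u := fun x (_ : Unit) => Real.sqrt g * x)
      fun _ => by fun_prop)

/-- Observing the `n` coordinates through independent scalar channels multiplies the scalar free
energy by `n`. -/
lemma integral_log_channelPartition_coord (hS : ∀ᵐ x ∂P₀, x ∈ S) {g : ℝ} (hg : 0 ≤ g) (n : ℕ) :
    ∫ w, Real.log (channelPartition (Measure.pi fun _ : Fin n => P₀)
        (fun x i => Real.sqrt g * x i) w.1 w.2)
      ∂((Measure.pi fun _ : Fin n => P₀).prod (stdGauss (Fin n))) =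
    n * scalarFreeEnergy P₀ g := by
  have hs : Real.sqrt g ^ 2 = g := Real.sq_sqrt hg
  have hprod : ∀ (x G : Fin n → ℝ), channelPartition (Measure.pi fun _ : Fin n => P₀)
      (fun x i => Real.sqrt g * x i) x G = ∏ i, scalarPartition P₀ g (x i) (G i) := by
    intro x G
    unfold channelPartition scalarPartition
    rw [← integral_fintype_prod_eq_prod]
    congr 1
    ext y
    rw [← Real.exp_sum, Finset.sum_div, ← Finset.sum_add_distrib, ← Finset.sum_sub_distrib]
    congr 1
    refine Finset.sum_congr rfl fun i _ => ?_
    linear_combination (y i * x i - y i ^ 2 / 2) * hs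
  have mp : ∀ i : Fin n, MeasurePreserving (fun w : (Fin n → ℝ) × (Fin n → ℝ) => (w.1 i, w.2 i))
      ((Measure.pi fun _ : Fin n => P₀).prod (stdGauss (Fin n)))
      (P₀.prod (gaussianReal 0 1)) := fun i =>
    (measurePreserving_eval (fun _ : Fin n => P₀) i).prod
      (measurePreserving_eval (fun _ : Fin n => gaussianReal 0 1) i)
  have hi := integrable_log_scalarPartition hS hg
  have hlog : ∀ w : (Fin n → ℝ) × (Fin n → ℝ),
      Real.log (channelPartition (Measure.pi fun _ : Fin n => P₀)
        (fun x i => Real.sqrt g * x i) w.1 w.2) =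
      ∑ i, Real.log (scalarPartition P₀ g (w.1 i) (w.2 i)) := fun w => by
    rw [hprod, Real.log_prod fun i _ => (scalarPartition_pos hS hg _ _).ne']
  simp only [hlog]
  have hi' : ∀ i, Integrable (fun w : (Fin n → ℝ) × (Fin n → ℝ) =>
      Real.log (scalarPartition P₀ g (w.1 i) (w.2 i)))
      ((Measure.pi fun _ : Fin n => P₀).prod (stdGauss (Fin n))) :=
    fun i => (mp i).integrable_comp_of_integrable hi
  rw [integral_finsetSum _ fun i _ => hi' i]
  have hc : ∀ i : Fin n, ∫ w, Real.log (scalarPartition P₀ g (w.1 i) (w.2 i))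
      ∂((Measure.pi fun _ : Fin n => P₀).prod (stdGauss (Fin n))) = scalarFreeEnergy P₀ g := by
    intro i
    rw [scalarFreeEnergy, ← (mp i).map_eq, integral_map (mp i).measurable.aemeasurable]
    rw [(mp i).map_eq]
    exact hi.aestronglyMeasurable
  simp [hc]

lemma sum_pairs_mul (n : ℕ) (r : Fin n → ℝ) :
    ∑ p : Pairs n, r p.1.1 * r p.1.2 = ((∑ i, r i) ^ 2 - ∑ i, r i ^ 2) / 2 := by
  have h1 : ∑ p : Pairs n, r p.1.1 * r p.1.2 = ∑ i, ∑ j, if i < j then r i * r j else 0 := by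
    rw [← Fintype.sum_prod_type' (f := fun i j => if i < j then r i * r j else 0),
      ← Finset.sum_filter]
    exact (Finset.sum_subtype _ (by simp) fun p : Fin n × Fin n => r p.1 * r p.2).symm
  have h2 : ∑ i, ∑ j, (if i < j then r i * r j else 0) =
      ∑ i, ∑ j, if j < i then r i * r j else 0 := by
    rw [Finset.sum_comm]
    simp only [mul_comm]
  have h3 : (∑ i, r i) ^ 2 = ∑ i, ∑ j, (if i < j then r i * r j else 0) +
      ∑ i, ∑ j, (if j < i then r i * r j else 0) + ∑ i, r i ^ 2 := by
    rw [pow_two, Finset.sum_mul_sum, ← Finset.sum_add_distrib, ← Finset.sum_add_distrib]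
    refine Finset.sum_congr rfl fun i _ => ?_
    have : r i ^ 2 = ∑ j, if i = j then r i * r j else 0 := by simp [pow_two]
    rw [this, ← Finset.sum_add_distrib, ← Finset.sum_add_distrib]
    refine Finset.sum_congr rfl fun j _ => ?_
    rcases lt_trichotomy i j with h | h | h
    · simp [h, h.ne, h.not_gt]
    · simp [h]
    · simp [h, h.ne', h.not_gt]
  rw [h1, h3, ← h2]
  ring

/-- The two covariances are `(l/2n) (R² - ∑ r_i²)` and `l q R` with `r_i = a_i b_i` and
`R = ∑ r_i`; completing the square in `R` compares them. -/
lemma covariance_le {l q B : ℝ} (hl : 0 ≤ l) {n : ℕ} (hn : n ≠ 0) {a b : Fin n → ℝ}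
    (ha : ∀ i, a i ^ 2 ≤ B) (hb : ∀ i, b i ^ 2 ≤ B) (hq : 0 ≤ q) :
    ∑ i, Real.sqrt (l * q) * a i * (Real.sqrt (l * q) * b i) -
        (l * n * q ^ 2 / 2 + l * B ^ 2 / 2) ≤
      ∑ p, pairSignal l n a p * pairSignal l n b p := by
  have hn' : (0 : ℝ) < n := by positivity
  have hs : Real.sqrt (l / n) ^ 2 = l / n := Real.sq_sqrt (by positivity)
  have hs2 : Real.sqrt (l * q) ^ 2 = l * q := Real.sq_sqrt (by positivity)
  have e1 : ∑ i, Real.sqrt (l * q) * a i * (Real.sqrt (l * q) * b i) =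
      l * q * ∑ i, a i * b i := by
    rw [Finset.mul_sum]
    exact Finset.sum_congr rfl fun i _ => by linear_combination a i * b i * hs2
  have e2 : ∑ p, pairSignal l n a p * pairSignal l n b p =
      l / n * (((∑ i, a i * b i) ^ 2 - ∑ i, (a i * b i) ^ 2) / 2) := by
    rw [← sum_pairs_mul n fun i => a i * b i, Finset.mul_sum]
    refine Finset.sum_congr rfl fun p _ => ?_
    simp only [pairSignal]
    linear_combination a p.1.1 * a p.1.2 * b p.1.1 * b p.1.2 * hs
  have e3 : ∑ i, (a i * b i) ^ 2 ≤ n * B ^ 2 := by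
    refine (Finset.sum_le_card_nsmul _ _ (B ^ 2) fun i _ => ?_).trans_eq (by simp)
    rw [mul_pow, pow_two B]
    exact mul_le_mul (ha i) (hb i) (sq_nonneg _) ((sq_nonneg _).trans (ha i))
  rw [e1, e2]
  set R := ∑ i, a i * b i
  have h0 : 0 ≤ l / n * ((R - n * q) ^ 2 / 2 + (n * B ^ 2 - ∑ i, (a i * b i) ^ 2) / 2) := by
    have := sub_nonneg.2 e3
    positivity
  have h4 : l / n * ((R - n * q) ^ 2 / 2 + (n * B ^ 2 - ∑ i, (a i * b i) ^ 2) / 2) =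
      l / n * ((R ^ 2 - ∑ i, (a i * b i) ^ 2) / 2) -
        (l * q * R - (l * n * q ^ 2 / 2 + l * B ^ 2 / 2)) := by
    field_simp
    ring
  linarith

/-- The bound at finite `n`: the free energy is at least the potential up to `O(1/n)`. -/
theorem potential_sub_le_freeEnergy (hS : ∀ᵐ x ∂P₀, x ∈ S) {l q : ℝ} (hl : 0 ≤ l) (hq : 0 ≤ q)
    {n : ℕ} (hn : n ≠ 0) :
    potential P₀ l q - l * (∑ s ∈ S, s ^ 2) ^ 2 / 4 / n ≤ freeEnergy P₀ l n := by
  have hT := ae_mem_piFinset hS n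
  have hn' : (0 : ℝ) < n := by positivity
  have hB : ∀ a : (Fintype.piFinset fun _ : Fin n => S), ∀ i,
      (a : Fin n → ℝ) i ^ 2 ≤ ∑ s ∈ S, s ^ 2 := fun a i =>
    Finset.single_le_sum (f := fun s : ℝ => s ^ 2) (fun s _ => sq_nonneg s)
      (Fintype.mem_piFinset.1 a.2 i)
  -- `relEntropy_sub_le` with `c = l n q² / 2 + l B² / 2`, `B = ∑ s ∈ S, s²`: dividing `c / 2` by
  -- `n` gives the term `l q² / 4` of the potential and an error `l B² / (4n)`.
  have key := relEntropy_sub_le (fun _ => measureReal_nonneg) (sum_prior_eq_one hT)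
    (fun a => pairSignal l n a) (fun a i => Real.sqrt (l * q) * (a : Fin n → ℝ) i)
    _ fun a b => covariance_le hl hn (hB a) (hB b) hq
  rw [← integral_log_channelPartition hT (measurable_pairSignal l n),
    ← integral_log_channelPartition hT (u := fun x i => Real.sqrt (l * q) * x i)
      (fun i => by fun_prop),
    integral_log_channelPartition_coord hS (by positivity)] at key
  simp only [freeEnergy, partition_eq_channelPartition hl, potential, jointLaw]
  rw [one_div_mul_eq_div, le_div_iff₀ hn']
  refine le_trans (le_of_eq ?_) key
  field_simp
  ring

end Wigner

end SpikedWigner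

theorem mainTheorem5 (P₀ : Measure ℝ) [IsProbabilityMeasure P₀]
    (S : Finset ℝ) (hS : P₀ ((S : Set ℝ)ᶜ) = 0) (l : ℝ) (hl : 0 ≤ l) :
    (∀ n : ℕ, Integrable
      (fun w : (Fin n → ℝ) × (SpikedWigner.Pairs n → ℝ) =>
        Real.log (SpikedWigner.partition P₀ l n w.1 w.2)) (SpikedWigner.jointLaw P₀ n)) ∧
    (∀ q : ℝ, 0 ≤ q → Integrable
      (fun w : ℝ × ℝ => Real.log (SpikedWigner.scalarPartition P₀ (l * q) w.1 w.2))
      (P₀.prod (gaussianReal 0 1))) ∧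
    liminf (fun n : ℕ => ((SpikedWigner.freeEnergy P₀ l n : ℝ) : EReal)) atTop ≥
      ⨆ q ∈ Set.Ici (0 : ℝ), ((SpikedWigner.potential P₀ l q : ℝ) : EReal) := by
  have hS' : ∀ᵐ x ∂P₀, x ∈ S := by
    rw [ae_iff]; exact hS
  refine ⟨SpikedWigner.integrable_log_partition hS' hl,
    fun q hq => SpikedWigner.integrable_log_scalarPartition hS' (mul_nonneg hl hq),
    iSup₂_le fun q hq => ?_⟩
  set C : ℝ := l * (∑ s ∈ S, s ^ 2) ^ 2 / 4
  have hlim : Tendsto (fun n : ℕ => ((SpikedWigner.potential P₀ l q - C / n : ℝ) : EReal)) atTop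
      (nhds ((SpikedWigner.potential P₀ l q : ℝ) : EReal)) := by
    refine (continuous_coe_real_ereal.tendsto _).comp ?_
    simpa using (tendsto_const_div_atTop_nhds_zero_nat C).const_sub
      (SpikedWigner.potential P₀ l q)
  rw [← hlim.liminf_eq]
  refine liminf_le_liminf ?_
  filter_upwards [eventually_ne_atTop 0] with n hn
  exact EReal.coe_le_coe_iff.2 (SpikedWigner.potential_sub_le_freeEnergy hS' hl hq hn)
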